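/- Let $\mathbb{D}=\{z\in\mathbb{C}:|z|<1\}$. Let $\psi$ be analytic and univalent in $\mathbb{D}$ with $\psi(0)=1$, $\operatorname{Re}\psi>0$ in $\mathbb{D}$, and with nonnegative real Taylor coefficients at $0$, and let $$h_\psi(z)=z\exp\left(\int_0^z\frac{\psi(t)-1}{t}\,dt\right).$$ Let $h$ be analytic in $\mathbb{D}$ with $h(0)=0$, $h'(0)=1$ and $zh'(z)/h(z)\prec\psi(z)$ (that is, $h\in\mathcal{S}^*(\psi)$; $\prec$ denotes subordination in $\mathbb{D}$), and let $g=\varphi h$ in $\mathbb{D}$, where $\varphi$ is analytic in $\mathbb{D}$ and $|\varphi|\le 1$. Suppose that $f=h+\overline{g}\in\mathcal{S}_{\mathcal H}^0$, that is, $f$ is univalent and sense-preserving ($|g'|<|h'|$) in $\mathbb{D}$, with $f(0)=0$, $h'(0)=1$, $g'(0)=0$. A locally univalent harmonic function $f$ is called uniformly starlike in $|z|<R$ if - it is fully starlike there: for every $0<\rho<R$ the circle $|z|=\rho$ is mapped one-to-one onto a curve that does not pass through $0$ and bounds a domain starlike with respect to $0$, and $\frac{\partial}{\partial\theta}\arg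 f(\rho e^{i\theta})>0$ for all $\theta$; and - for every circular arc $\Gamma_\zeta$ contained in $|z|<R$ with center $\zeta$, $|\zeta|<R$, the arc $f(\Gamma_\zeta)$ is starlike with respect to $f(\zeta)$, i.e. $f\ne f(\zeta)$ on $\Gamma_\zeta$ and $\arg\big(f(z)-f(\zeta)\big)$ is nondecreasing as $z$ traverses $\Gamma_\zeta$ in the positive direction. Then: 1. $f$ is uniformly starlike in $|z|<\min\{1/3,r_\psi\}$, where $r_\psi$ is the smallest root in $(0,1)$ of $h_\psi'(r)-\frac54=0$. 2. The function $$F(z)=\Lambda_{0,1}[f](z)=\int_0^z\frac{h(\xi)}{\xi}\,d\xi+\overline{\int_0^z\frac{g(\xi)}{\xi}\,d\xi}$$ is uniformly starlike in $|z|<\min\{1/3,r_\psi\}$, where $r_\psi$ is the smallest root in $(0,1)$ of $4h_\psi(r)-5r=0$. In each part, if the equation has a root in $(0,1)$ then a smallest one exists; if it has none, the assertion holds with $1/3$ in place of $\min\{1/3,r_\psi\}$. -/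

import Mathlib

open Complex ComplexConjugate Set Metric

noncomputable section

/-- The open unit disk. -/
def unitDisk : Set ℂ := ball 0 1

/-- The integral of `F` from `0` to `z` along the segment `t = s z`, `0 ≤ s ≤ 1`. -/
def integralFromZero (F : ℂ → ℂ) (z : ℂ) : ℂ :=
  ∫ s in (0 : ℝ)..1, F ((s : ℂ) * z) * z

/-- The functions `ψ(z) = 1 + p₁ z + p₂ z² + ⋯` admitted in the Ma-Minda classes: univalent in the
disk, with positive real part, and with nonnegative real Taylor coefficients at the origin. -/
structure IsMaMindaFunction (ψ : ℂ → ℂ) : Prop where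
  differentiableOn : DifferentiableOn ℂ ψ unitDisk
  injOn : InjOn ψ unitDisk
  map_zero : ψ 0 = 1
  re_pos : ∀ z ∈ unitDisk, 0 < (ψ z).re
  coeff_nonneg : ∀ n : ℕ, 0 ≤ (iteratedDeriv n ψ 0).re ∧ (iteratedDeriv n ψ 0).im = 0

/-- Subordination `p ≺ q` in the unit disk: `p = q ∘ ω` for a Schwarz function `ω`. -/
def Subordinate (p q : ℂ → ℂ) : Prop :=
  ∃ ω : ℂ → ℂ, DifferentiableOn ℂ ω unitDisk ∧ MapsTo ω unitDisk unitDisk ∧ ω 0 = 0 ∧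
    ∀ z ∈ unitDisk, p z = q (ω z)

/-- `z h'(z) / h(z)`, with its limiting value `1` at the origin (`h(0) = 0`, `h'(0) = 1`). -/
def starlikeQuotient (h : ℂ → ℂ) (z : ℂ) : ℂ :=
  if z = 0 then 1 else z * deriv h z / h z

/-- Membership of `h` in the Ma-Minda class `S*(ψ)`. A zero of `h` at some
`z ≠ 0` is excluded, because the quotient is then `0` in Lean while `ψ` omits the value `0`. -/
structure IsMaMindaStarlike (ψ h : ℂ → ℂ) : Prop where
  differentiableOn : DifferentiableOn ℂ h unitDisk
  map_zero : h 0 = 0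
  deriv_zero : deriv h 0 = 1
  subordinate : Subordinate (starlikeQuotient h) ψ

/-- The function `h_ψ(z) = z exp (∫₀ᶻ (ψ(t) - 1) / t dt)`. -/
def maMindaExtremal (ψ : ℂ → ℂ) (z : ℂ) : ℂ :=
  z * exp (integralFromZero (fun t => (ψ t - 1) / t) z)

/-- The class of analytic functions on the unit disk that are bounded by `1` there. -/
structure IsBoundedByOne (φ : ℂ → ℂ) : Prop where
  differentiableOn : DifferentiableOn ℂ φ unitDisk
  norm_le_one : ∀ z ∈ unitDisk, ‖φ z‖ ≤ 1

/-- The harmonic mapping `f = h + conj g`. -/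
def harmonicMap (h g : ℂ → ℂ) (z : ℂ) : ℂ := h z + conj (g z)

/-- The mapping `f = h + conj g` is of class `S_H⁰`: harmonic, univalent and sense-preserving
(`|f_z|² - |f_z̄|² = |h'|² - |g'|² > 0`) in the unit disk, with `h(0) = g(0) = 0`,
`f_z(0) = h'(0) = 1` and `conj (f_z̄(0)) = g'(0) = 0`. -/
structure IsClassSH0 (h g : ℂ → ℂ) : Prop where
  differentiableOn_left : DifferentiableOn ℂ h unitDisk
  differentiableOn_right : DifferentiableOn ℂ g unitDisk
  injOn : InjOn (harmonicMap h g) unitDisk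
  jacobian_pos : ∀ z ∈ unitDisk, 0 < ‖deriv h z‖ ^ 2 - ‖deriv g z‖ ^ 2
  left_zero : h 0 = 0
  right_zero : g 0 = 0
  deriv_left_zero : deriv h 0 = 1
  deriv_right_zero : deriv g 0 = 0

/-- The operator `Λ_{0,1}`: `F(z) = ∫₀ᶻ h(ξ)/ξ dξ + conj (∫₀ᶻ g(ξ)/ξ dξ)`. -/
def lambdaOperator (h g : ℂ → ℂ) : ℂ → ℂ :=
  harmonicMap (integralFromZero fun ξ => h ξ / ξ) (integralFromZero fun ξ => g ξ / ξ)

/-- The point `ζ + ρ e^{iθ}`. -/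
def circlePoint (ζ : ℂ) (ρ θ : ℝ) : ℂ := ζ + ρ * exp (θ * I)

/-- `A` is a choice of the argument of the nowhere vanishing function `c` on the set `s`. -/
def IsArgumentOn (c : ℝ → ℂ) (A : ℝ → ℝ) (s : Set ℝ) : Prop :=
  ∀ θ ∈ s, c θ ≠ 0 ∧ c θ = ‖c θ‖ * exp (A θ * I)

/-- `f` is fully starlike in `|z| < R`: every circle `|z| = ρ < R` is mapped one-to-one onto a curve
which bounds a domain that is starlike with respect to the origin, and
`∂/∂θ arg f(ρ e^{iθ}) > 0`. -/
def IsFullyStarlike (f : ℂ → ℂ) (R : ℝ) : Prop :=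
  ∀ ρ : ℝ, 0 < ρ → ρ < R →
    InjOn f (sphere 0 ρ) ∧
    (∃ Ω : Set ℂ, IsOpen Ω ∧ Ω.Nonempty ∧ Bornology.IsBounded Ω ∧ StarConvex ℝ 0 Ω ∧
      frontier Ω = f '' sphere 0 ρ) ∧
    ∃ A : ℝ → ℝ, IsArgumentOn (fun θ => f (circlePoint 0 ρ θ)) A univ ∧
      ∀ θ : ℝ, ∃ d : ℝ, HasDerivAt A d θ ∧ 0 < d

/-- The image under `f` of the arc `ζ + ρ e^{iθ}`, `α ≤ θ ≤ β`, is starlike with respect to `w`: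
a continuous branch of the argument of `f - w` is nondecreasing along the arc. -/
def IsStarlikeArc (f : ℂ → ℂ) (ζ : ℂ) (ρ α β : ℝ) (w : ℂ) : Prop :=
  ∃ A : ℝ → ℝ, ContinuousOn A (Icc α β) ∧
    IsArgumentOn (fun θ => f (circlePoint ζ ρ θ) - w) A (Icc α β) ∧ MonotoneOn A (Icc α β)

/-- `f` is uniformly starlike in `|z| < R`: it is harmonic, locally univalent and fully starlike
there, and maps every circular arc that is contained in this disk and has its center `ζ` in this
disk onto an arc which is starlike with respect to `f ζ`. -/
structure IsUniformlyStarlike (f : ℂ → ℂ) (R : ℝ) : Prop where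
  harmonic : InnerProductSpace.HarmonicOnNhd f (ball 0 R)
  locallyUnivalent : ∀ z ∈ ball (0 : ℂ) R, ∃ U ∈ nhds z, InjOn f U
  fullyStarlike : IsFullyStarlike f R
  arcs : ∀ ζ ∈ ball (0 : ℂ) R, ∀ ρ α β : ℝ, 0 < ρ → α < β → β ≤ α + 2 * Real.pi →
    (∀ θ ∈ Icc α β, circlePoint ζ ρ θ ∈ ball (0 : ℂ) R) → IsStarlikeArc f ζ ρ α β (f ζ)

/-- The roots in `(0,1)` of `h_ψ'(r) - 5/4 = 0`. -/
def derivRoots (ψ : ℂ → ℂ) : Set ℝ :=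
  {r | r ∈ Ioo (0 : ℝ) 1 ∧ deriv (maMindaExtremal ψ) (r : ℂ) - 5 / 4 = 0}

/-- The roots in `(0,1)` of `4 h_ψ(r) - 5 r = 0`. -/
def valueRoots (ψ : ℂ → ℂ) : Set ℝ :=
  {r | r ∈ Ioo (0 : ℝ) 1 ∧ 4 * maMindaExtremal ψ (r : ℂ) - 5 * (r : ℂ) = 0}

end

/-!
The function `h_ψ` majorizes the class `S*(ψ)`: for `|z| = r` one has
`|h'(z) - 1| ≤ h_ψ'(r) - 1` and `|h(z)/z - 1| ≤ h_ψ(r)/r - 1`. Up to the radius in the theorem these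
bounds are at most `1/4`, and Schwarz's lemma applied to `g'/h'` (or to `φ`) gives
`|g'| ≤ r |h'| ≤ 5/12` there. The real derivative of `f` is thus within `2/3 < 1/√2` of the
identity, and so every difference quotient `(f z - f w) / (z - w)` lies in the sector
`|arg| < π/4`, as does every quotient `Df(z) v / v`. Along a circle centred at `ζ`, chord and
velocity are orthogonal before `f` is applied and enclose an angle in `(0, π)` afterwards, so that
`arg (f z - f ζ)` increases.
-/

open scoped NNReal ComplexOrder Topology

section QuarterSector

/-- The sector `|arg z| < π / 4`. Two of its elements enclose an angle less than `π / 2`. -/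
def quarterSector : Set ℂ := {z | |z.im| < z.re}

variable {a b : ℂ} {k : ℝ}

theorem mem_quarterSector_of_norm_sub_one_le (hk : 2 * k ^ 2 < 1) (ha : ‖a - 1‖ ≤ k) :
    a ∈ quarterSector := by
  have hsq : (a.re - 1) ^ 2 + a.im ^ 2 ≤ k ^ 2 := by
    calc (a.re - 1) ^ 2 + a.im ^ 2 = ‖a - 1‖ ^ 2 := by
          rw [← normSq_eq_norm_sq, normSq_apply, sub_re, sub_im, one_re, one_im]
          ring
      _ ≤ k ^ 2 := by gcongr
  have hre : 0 < a.re := by nlinarith [sq_nonneg a.re, sq_nonneg a.im]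
  exact abs_lt_of_sq_lt_sq (by nlinarith [sq_nonneg (2 * a.re - 1)]) hre.le

theorem re_pos_of_mem_quarterSector (ha : a ∈ quarterSector) : 0 < a.re :=
  (abs_nonneg _).trans_lt ha

theorem ne_zero_of_mem_quarterSector (ha : a ∈ quarterSector) : a ≠ 0 := by
  rintro rfl
  exact (re_pos_of_mem_quarterSector ha).false

theorem re_div_pos_of_mem_quarterSector (ha : a ∈ quarterSector) (hb : b ∈ quarterSector) :
    0 < (a / b).re := by
  have him : |a.im * b.im| < a.re * b.re := by
    rw [abs_mul]
    exact mul_lt_mul'' ha hb (abs_nonneg _) (abs_nonneg _)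
  rw [div_re, ← add_div]
  exact div_pos (by linarith [neg_abs_le (a.im * b.im)])
    (normSq_pos.2 (ne_zero_of_mem_quarterSector hb))

end QuarterSector

section NearIdentity

section NormedSpace

variable {E F : Type*} [NormedAddCommGroup E] [NormedSpace ℝ E]

theorem isOpen_image_of_approximatesLinearOn_id [CompleteSpace E] {f : E → E} {s : Set E}
    {k : ℝ≥0} (hf : ApproximatesLinearOn f (.id ℝ E) s k) (hk : k < 1) (hs : IsOpen s) :
    IsOpen (f '' s) :=
  hf.open_image ⟨id, 1, by simp, fun _ => rfl⟩ hs (.inr (by simpa using hk))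

theorem injOn_of_approximatesLinearOn_id {f : E → E} {s : Set E} {k : ℝ≥0}
    (hf : ApproximatesLinearOn f (.id ℝ E) s k) (hk : k < 1) : InjOn f s := by
  intro x hx y hy hxy
  have h : ‖x - y‖ ≤ k * ‖x - y‖ := by simpa [hxy, norm_sub_rev] using hf x hx y hy
  by_contra hne
  have hpos : 0 < ‖x - y‖ := norm_sub_pos_iff.2 hne
  exact (mul_lt_of_lt_one_left hpos (NNReal.coe_lt_one.2 hk)).not_ge h

theorem closure_image_ball_eq [ProperSpace E] [TopologicalSpace F] [T2Space F] {f : E → F} {x : E}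
    {ρ : ℝ} (hρ : ρ ≠ 0) (hf : ContinuousOn f (closedBall x ρ)) :
    closure (f '' ball x ρ) = f '' closedBall x ρ := by
  refine (closure_minimal (image_mono ball_subset_closedBall)
    ((isCompact_closedBall x ρ).image_of_continuousOn hf).isClosed).antisymm ?_
  rw [← closure_ball x hρ] at hf ⊢
  exact hf.image_closure

end NormedSpace

variable {f : ℂ → ℂ} {s : Set ℂ} {k : ℝ≥0} {x y z : ℂ} {ρ : ℝ}

theorem sub_div_sub_mem_quarterSector (hf : ApproximatesLinearOn f (.id ℝ ℂ) s k)
    (hk : 2 * (k : ℝ) ^ 2 < 1) (hx : x ∈ s) (hy : y ∈ s) (hxy : x ≠ y) :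
    (f x - f y) / (x - y) ∈ quarterSector := by
  have hne : x - y ≠ 0 := sub_ne_zero.2 hxy
  have hle : ‖f x - f y - (x - y)‖ ≤ k * ‖x - y‖ := by simpa using hf x hx y hy
  refine mem_quarterSector_of_norm_sub_one_le hk ?_
  rwa [div_sub_one hne, norm_div, div_le_iff₀ (norm_pos_iff.2 hne)]

theorem apply_div_mem_quarterSector {f' : ℂ →L[ℝ] ℂ} {v : ℂ}
    (hf : ApproximatesLinearOn f (.id ℝ ℂ) s k) (hk : 2 * (k : ℝ) ^ 2 < 1) (hs : s ∈ 𝓝 x)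
    (hf' : HasFDerivAt f f' x) (hv : v ≠ 0) : f' v / v ∈ quarterSector := by
  have hsub : HasFDerivAt (f - id) (f' - ContinuousLinearMap.id ℝ ℂ) x :=
    hf'.sub (hasFDerivAt_id x)
  have hlip : LipschitzOnWith k (f - id) s := by simpa using hf.lipschitzOnWith
  have hle : ‖f' v - v‖ ≤ k * ‖v‖ :=
    ContinuousLinearMap.le_of_opNorm_le _ (hsub.le_of_lipschitzOn hs hlip) v
  refine mem_quarterSector_of_norm_sub_one_le hk ?_
  rwa [div_sub_one hv, norm_div, div_le_iff₀ (norm_pos_iff.2 hv)]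

/-- The vectors `z - y` and `y` both enclose an angle less than `π / 4` with their images
`f z - f y` and `f y`, which point in the same direction. -/
theorem norm_le_norm_of_eq_smul (hf : ApproximatesLinearOn f (.id ℝ ℂ) s k)
    (hk : 2 * (k : ℝ) ^ 2 < 1) (h0s : 0 ∈ s) (h0 : f 0 = 0) (hy : y ∈ s) (hz : z ∈ s) {t : ℝ}
    (ht : t ∈ Icc (0 : ℝ) 1) (hyz : f y = t • f z) : ‖y‖ ≤ ‖z‖ := by
  rcases eq_or_ne y 0 with rfl | hy0
  · simp
  rcases eq_or_ne z y with rfl | hzy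
  · rfl
  have hb : f y / y ∈ quarterSector := by
    simpa [h0] using sub_div_sub_mem_quarterSector hf hk hy h0s hy0
  have ha := sub_div_sub_mem_quarterSector hf hk hz hy hzy
  have hfy : f y ≠ 0 := (div_ne_zero_iff.1 (ne_zero_of_mem_quarterSector hb)).1
  have hfzy : f z - f y ≠ 0 := (div_ne_zero_iff.1 (ne_zero_of_mem_quarterSector ha)).1
  have hzy' : z - y ≠ 0 := sub_ne_zero.2 hzy
  have ht0 : t ≠ 0 := by
    rintro rfl
    simp [hfy] at hyz
  have hquot : (z - y) / y = ((1 - t) / t : ℝ) * ((f y / y) / ((f z - f y) / (z - y))) := by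
    have htC : (t : ℂ) ≠ 0 := ofReal_ne_zero.2 ht0
    rw [real_smul] at hyz
    push_cast
    field_simp
    rw [hyz]
    ring
  have hre : 0 ≤ ((z - y) / y).re := by
    rw [hquot, re_ofReal_mul]
    exact mul_nonneg (div_nonneg (sub_nonneg.2 ht.2) ht.1)
      (re_div_pos_of_mem_quarterSector hb ha).le
  have hone : 1 ≤ ‖z / y‖ := by
    rw [sub_div, div_self hy0, sub_re, one_re, sub_nonneg] at hre
    exact hre.trans (re_le_norm _)
  rwa [norm_div, one_le_div (norm_pos_iff.2 hy0)] at hone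

theorem starConvex_image_ball (hf : ApproximatesLinearOn f (.id ℝ ℂ) (closedBall 0 ρ) k)
    (hk : 2 * (k : ℝ) ^ 2 < 1) (hopen : IsOpen (f '' ball 0 ρ)) (h0 : f 0 = 0) :
    StarConvex ℝ 0 (f '' ball 0 ρ) := by
  rw [starConvex_iff_segment_subset]
  rintro _ ⟨z, hz, rfl⟩
  have hρ : 0 < ρ := pos_of_mem_ball hz
  refine (convex_segment (𝕜 := ℝ) 0 (f z)).isPreconnected.subset_of_closure_inter_subset hopen
    ⟨f z, right_mem_segment ℝ 0 (f z), z, hz, rfl⟩ ?_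
  rw [closure_image_ball_eq hρ.ne' hf.continuousOn, segment_eq_image]
  rintro _ ⟨⟨y, hy, rfl⟩, t, ht, hyt⟩
  have hle : ‖y‖ ≤ ‖z‖ := norm_le_norm_of_eq_smul hf hk (mem_closedBall_self hρ.le) h0 hy
    (ball_subset_closedBall hz) ht (by simpa using hyt.symm)
  exact ⟨y, mem_ball_zero_iff.2 (hle.trans_lt (mem_ball_zero_iff.1 hz)), rfl⟩

end NearIdentity

section Argument

/-- The branch of the argument of the curve `c` that differs from the parameter `θ` by at most `π`.
It is differentiable where `c θ * exp (-θ i)` avoids the cut of `arg`. -/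
noncomputable def rotatingArg (c : ℝ → ℂ) (θ : ℝ) : ℝ := θ + arg (c θ * exp (-(θ * I)))

variable {c : ℝ → ℂ} {θ : ℝ}

theorem isArgumentOn_rotatingArg {s : Set ℝ} (hc : ∀ θ ∈ s, c θ ≠ 0) :
    IsArgumentOn c (rotatingArg c) s := by
  refine fun θ hθ => ⟨hc θ hθ, ?_⟩
  have hnorm : ‖c θ * exp (-(θ * I))‖ = ‖c θ‖ := by
    rw [norm_mul, ← neg_mul, ← ofReal_neg, norm_exp_ofReal_mul_I, mul_one]
  calc c θ = exp (θ * I) * (c θ * exp (-(θ * I))) := by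
        rw [exp_neg]
        field_simp
    _ = exp (θ * I) * (‖c θ‖ * exp (arg (c θ * exp (-(θ * I))) * I)) := by
        rw [← hnorm, norm_mul_exp_arg_mul_I]
    _ = ‖c θ‖ * exp (rotatingArg c θ * I) := by
        rw [rotatingArg, ofReal_add, add_mul, exp_add]
        ring

theorem hasDerivAt_rotatingArg {c' : ℂ} (hc : HasDerivAt c c' θ)
    (hslit : c θ * exp (-(θ * I)) ∈ slitPlane) :
    HasDerivAt (rotatingArg c) (c' / c θ).im θ := by
  have hcθ : c θ ≠ 0 := left_ne_zero_of_mul (slitPlane_ne_zero hslit)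
  have hrot : HasDerivAt (fun t : ℝ => exp (-(t * I))) (exp (-(θ * I)) * -I) θ := by
    simpa using! (ofRealCLM.hasDerivAt.mul_const I).neg.cexp
  have hquot : (c' * exp (-(θ * I)) + c θ * (exp (-(θ * I)) * -I)) / (c θ * exp (-(θ * I))) =
      c' / c θ - I := by
    field_simp
    ring
  have hlog : HasDerivAt (fun t : ℝ => log (c t * exp (-(t * I)))) (c' / c θ - I) θ :=
    hquot ▸ (hc.mul hrot).clog_real hslit
  have harg : HasDerivAt (fun t : ℝ => arg (c t * exp (-(t * I)))) (c' / c θ - I).im θ := by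
    simpa [Function.comp_def, log_im] using imCLM.hasFDerivAt.comp_hasDerivAt θ hlog
  exact ((hasDerivAt_id θ).add harg).congr_deriv (by simp)

theorem circlePoint_sub_center (ζ : ℂ) (ρ θ : ℝ) : circlePoint ζ ρ θ - ζ = ρ * exp (θ * I) :=
  add_sub_cancel_left _ _

theorem hasDerivAt_circlePoint (ζ : ℂ) (ρ θ : ℝ) :
    HasDerivAt (circlePoint ζ ρ) (I * (circlePoint ζ ρ θ - ζ)) θ := by
  rw [circlePoint_sub_center]
  have hexp : HasDerivAt (fun t : ℝ => exp (t * I)) (exp (θ * I) * I) θ := by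
    simpa using! (ofRealCLM.hasDerivAt.mul_const I).cexp
  exact ((hexp.const_mul (ρ : ℂ)).const_add ζ).congr_deriv (by ring)

end Argument

section UniformStarlikeness

variable {f : ℂ → ℂ} {k : ℝ≥0} {s : Set ℂ} {R ρ θ : ℝ} {ζ : ℂ}

theorem hasDerivAt_rotatingArg_circlePoint_pos (hf : ApproximatesLinearOn f (.id ℝ ℂ) s k)
    (hk : 2 * (k : ℝ) ^ 2 < 1) (hρ : 0 < ρ) (hζ : ζ ∈ s) (hs : s ∈ 𝓝 (circlePoint ζ ρ θ))
    (hd : DifferentiableAt ℝ f (circlePoint ζ ρ θ)) :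
    ∃ d, HasDerivAt (rotatingArg fun t => f (circlePoint ζ ρ t) - f ζ) d θ ∧ 0 < d := by
  set z := circlePoint ζ ρ θ with hz
  have hzζ : z - ζ = ρ * exp (θ * I) := circlePoint_sub_center ζ ρ θ
  have hzζ0 : z - ζ ≠ 0 := by
    rw [hzζ]
    exact mul_ne_zero (ofReal_ne_zero.2 hρ.ne') (exp_ne_zero _)
  have hchord : (f z - f ζ) / (z - ζ) ∈ quarterSector :=
    sub_div_sub_mem_quarterSector hf hk (mem_of_mem_nhds hs) hζ (sub_ne_zero.1 hzζ0)
  have hvelocity : fderiv ℝ f z (I * (z - ζ)) / (I * (z - ζ)) ∈ quarterSector :=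
    apply_div_mem_quarterSector hf hk hs hd.hasFDerivAt (mul_ne_zero I_ne_zero hzζ0)
  have hchordre := re_pos_of_mem_quarterSector hchord
  have hcurve : HasDerivAt (fun t => f (circlePoint ζ ρ t) - f ζ)
      (fderiv ℝ f z (I * (z - ζ))) θ :=
    (hd.hasFDerivAt.comp_hasDerivAt θ (hasDerivAt_circlePoint ζ ρ θ)).sub_const _
  have hslit : (f z - f ζ) * exp (-(θ * I)) ∈ slitPlane := by
    have heq : (f z - f ζ) * exp (-(θ * I)) = ρ * ((f z - f ζ) / (z - ζ)) := by
      have hρC : (ρ : ℂ) ≠ 0 := ofReal_ne_zero.2 hρ.ne'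
      rw [hzζ, exp_neg]
      field_simp
    rw [heq]
    exact Or.inl (by rw [re_ofReal_mul]; exact mul_pos hρ hchordre)
  refine ⟨_, hasDerivAt_rotatingArg hcurve hslit, ?_⟩
  have hfz : f z - f ζ ≠ 0 := (div_ne_zero_iff.1 (ne_zero_of_mem_quarterSector hchord)).1
  have hratio : fderiv ℝ f z (I * (z - ζ)) / (f z - f ζ) =
      I * ((fderiv ℝ f z (I * (z - ζ)) / (I * (z - ζ))) / ((f z - f ζ) / (z - ζ))) := by
    field_simp
  rw [← hz, hratio, I_mul_im]
  exact re_div_pos_of_mem_quarterSector hvelocity hchord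

theorem frontier_image_ball_eq (hf : ApproximatesLinearOn f (.id ℝ ℂ) (closedBall ζ ρ) k)
    (hk : k < 1) (hρ : ρ ≠ 0) : frontier (f '' ball ζ ρ) = f '' sphere ζ ρ := by
  have hopen : IsOpen (f '' ball ζ ρ) :=
    isOpen_image_of_approximatesLinearOn_id (hf.mono_set ball_subset_closedBall) hk isOpen_ball
  rw [frontier, closure_image_ball_eq hρ hf.continuousOn, hopen.interior_eq,
    ← closedBall_sdiff_ball]
  exact ((injOn_of_approximatesLinearOn_id hf hk).image_sdiff_subset ball_subset_closedBall).symm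

theorem lt_one_of_two_mul_sq_lt_one (hk : 2 * (k : ℝ) ^ 2 < 1) : k < 1 := by
  rw [← NNReal.coe_lt_one]
  nlinarith

theorem isFullyStarlike_of_approximatesLinearOn_id
    (hf : ApproximatesLinearOn f (.id ℝ ℂ) (ball 0 R) k) (hk : 2 * (k : ℝ) ^ 2 < 1) (h0 : f 0 = 0)
    (hd : ∀ z ∈ ball 0 R, DifferentiableAt ℝ f z) : IsFullyStarlike f R := by
  intro ρ hρ hρR
  have hk1 := lt_one_of_two_mul_sq_lt_one hk
  have hball : closedBall 0 ρ ⊆ ball (0 : ℂ) R := closedBall_subset_ball hρR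
  have hsphere : sphere 0 ρ ⊆ ball (0 : ℂ) R := sphere_subset_closedBall.trans hball
  have hfρ := hf.mono_set hball
  have hopen : IsOpen (f '' ball 0 ρ) :=
    isOpen_image_of_approximatesLinearOn_id (hfρ.mono_set ball_subset_closedBall) hk1 isOpen_ball
  have hinj : InjOn f (ball 0 R) := injOn_of_approximatesLinearOn_id hf hk1
  have h0R : (0 : ℂ) ∈ ball 0 R := mem_ball_self (hρ.trans hρR)
  have hcircle (θ : ℝ) : circlePoint 0 ρ θ ∈ sphere 0 ρ := by
    simp [circlePoint, norm_exp_ofReal_mul_I, abs_of_pos hρ]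
  refine ⟨hinj.mono hsphere, ⟨f '' ball 0 ρ, hopen, (nonempty_ball.2 hρ).image f, ?_,
    starConvex_image_ball hfρ hk hopen h0, frontier_image_ball_eq hfρ hk1 hρ.ne'⟩,
    rotatingArg _, isArgumentOn_rotatingArg fun θ _ hθ => ?_, fun θ => ?_⟩
  · exact ((isCompact_closedBall 0 ρ).image_of_continuousOn hfρ.continuousOn).isBounded.subset
      (image_mono ball_subset_closedBall)
  · have h := hcircle θ
    rw [hinj (hsphere h) h0R (hθ.trans h0.symm), mem_sphere, dist_self] at h
    exact hρ.ne h
  · simpa only [h0, sub_zero] using hasDerivAt_rotatingArg_circlePoint_pos hf hk hρ h0R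
      (isOpen_ball.mem_nhds (hsphere (hcircle θ))) (hd _ (hsphere (hcircle θ)))

theorem isStarlikeArc_of_approximatesLinearOn_id (hf : ApproximatesLinearOn f (.id ℝ ℂ) s k)
    (hk : 2 * (k : ℝ) ^ 2 < 1) (hs : IsOpen s) (hd : ∀ z ∈ s, DifferentiableAt ℝ f z)
    (hζ : ζ ∈ s) (hρ : 0 < ρ) {α β : ℝ} (harc : ∀ θ ∈ Icc α β, circlePoint ζ ρ θ ∈ s) :
    IsStarlikeArc f ζ ρ α β (f ζ) := by
  have hderiv (θ : ℝ) (hθ : θ ∈ Icc α β) :=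
    hasDerivAt_rotatingArg_circlePoint_pos hf hk hρ hζ (hs.mem_nhds (harc θ hθ))
      (hd _ (harc θ hθ))
  have hcont : ContinuousOn (rotatingArg fun t => f (circlePoint ζ ρ t) - f ζ) (Icc α β) := by
    intro θ hθ
    obtain ⟨d, hd, -⟩ := hderiv θ hθ
    exact hd.continuousAt.continuousWithinAt
  refine ⟨_, hcont, isArgumentOn_rotatingArg fun θ hθ => ?_,
    monotoneOn_of_deriv_nonneg (convex_Icc α β) hcont (fun θ hθ => ?_) fun θ hθ => ?_⟩
  · refine sub_ne_zero.2 ((injOn_of_approximatesLinearOn_id hf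
      (lt_one_of_two_mul_sq_lt_one hk)).ne (harc θ hθ) hζ ?_)
    rw [← sub_ne_zero, circlePoint_sub_center]
    exact mul_ne_zero (ofReal_ne_zero.2 hρ.ne') (exp_ne_zero _)
  · obtain ⟨d, hd, -⟩ := hderiv θ (interior_subset hθ)
    exact hd.differentiableAt.differentiableWithinAt
  · obtain ⟨d, hd, hpos⟩ := hderiv θ (interior_subset hθ)
    exact hd.deriv ▸ hpos.le

theorem isUniformlyStarlike_of_approximatesLinearOn_id
    (hf : ApproximatesLinearOn f (.id ℝ ℂ) (ball 0 R) k) (hk : 2 * (k : ℝ) ^ 2 < 1) (h0 : f 0 = 0)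
    (hharm : InnerProductSpace.HarmonicOnNhd f (ball 0 R)) : IsUniformlyStarlike f R := by
  have hd (z : ℂ) (hz : z ∈ ball 0 R) : DifferentiableAt ℝ f z :=
    (hharm z hz).1.differentiableAt two_ne_zero
  exact {
    harmonic := hharm
    locallyUnivalent := fun z hz => ⟨ball 0 R, isOpen_ball.mem_nhds hz,
      injOn_of_approximatesLinearOn_id hf (lt_one_of_two_mul_sq_lt_one hk)⟩
    fullyStarlike := isFullyStarlike_of_approximatesLinearOn_id hf hk h0 hd
    arcs := fun _ hζ _ _ _ hρ _ _ harc =>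
      isStarlikeArc_of_approximatesLinearOn_id hf hk isOpen_ball hd hζ hρ harc }

end UniformStarlikeness

section HarmonicMap

variable {h g : ℂ → ℂ} {s : Set ℂ} {k : ℝ≥0} {R : ℝ}

theorem approximatesLinearOn_harmonicMap (hs : Convex ℝ s) (hh : ∀ z ∈ s, DifferentiableAt ℂ h z)
    (hg : ∀ z ∈ s, DifferentiableAt ℂ g z) (hk : ∀ z ∈ s, ‖deriv h z - 1‖ + ‖deriv g z‖ ≤ k) :
    ApproximatesLinearOn (harmonicMap h g) (.id ℝ ℂ) s k := by
  let D (z : ℂ) : ℂ →L[ℝ] ℂ := deriv h z • 1 + (conjCLE : ℂ →L[ℝ] ℂ) ∘L (deriv g z • 1)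
  have hD (z : ℂ) (hz : z ∈ s) : HasFDerivAt (harmonicMap h g) (D z) z :=
    (hh z hz).hasDerivAt.complexToReal_fderiv.add
      ((conjCLE : ℂ →L[ℝ] ℂ).hasFDerivAt.comp z (hg z hz).hasDerivAt.complexToReal_fderiv)
  have hnorm (z : ℂ) (hz : z ∈ s) : ‖D z - ContinuousLinearMap.id ℝ ℂ‖ ≤ k := by
    refine ContinuousLinearMap.opNorm_le_bound _ k.coe_nonneg fun v => ?_
    calc ‖(D z - ContinuousLinearMap.id ℝ ℂ) v‖
        = ‖(deriv h z - 1) * v + conj (deriv g z * v)‖ := by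
          simp only [D, sub_apply, add_apply, smul_apply, one_apply_eq_self, smul_eq_mul,
            ContinuousLinearMap.comp_apply, ContinuousLinearMap.id_apply,
            ContinuousLinearEquiv.coe_coe, conjCLE_apply]
          ring_nf
      _ ≤ ‖deriv h z - 1‖ * ‖v‖ + ‖deriv g z‖ * ‖v‖ := by
          refine (norm_add_le _ _).trans_eq ?_
          rw [norm_conj, norm_mul, norm_mul]
      _ ≤ k * ‖v‖ := by
          rw [← add_mul]
          gcongr
          exact hk z hz
  exact fun x hx y hy => hs.norm_image_sub_le_of_norm_hasFDerivWithin_le'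
    (fun z hz => (hD z hz).hasFDerivWithinAt) hnorm hy hx

theorem harmonicOnNhd_harmonicMap (hs : IsOpen s) (hh : DifferentiableOn ℂ h s)
    (hg : DifferentiableOn ℂ g s) : InnerProductSpace.HarmonicOnNhd (harmonicMap h g) s :=
  fun _ hz => ((hh.analyticAt (hs.mem_nhds hz)).harmonicAt).add
    ((hg.analyticAt (hs.mem_nhds hz)).harmonicAt_conj)

theorem isUniformlyStarlike_harmonicMap (hh : DifferentiableOn ℂ h (ball 0 R))
    (hg : DifferentiableOn ℂ g (ball 0 R)) (h0 : h 0 = 0) (g0 : g 0 = 0)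
    (hk : 2 * (k : ℝ) ^ 2 < 1) (hhg : ∀ z ∈ ball 0 R, ‖deriv h z - 1‖ + ‖deriv g z‖ ≤ k) :
    IsUniformlyStarlike (harmonicMap h g) R :=
  isUniformlyStarlike_of_approximatesLinearOn_id
    (approximatesLinearOn_harmonicMap (convex_ball 0 R)
      (fun _ hz => hh.differentiableAt (isOpen_ball.mem_nhds hz))
      (fun _ hz => hg.differentiableAt (isOpen_ball.mem_nhds hz)) hhg)
    hk (by simp [harmonicMap, h0, g0]) (harmonicOnNhd_harmonicMap isOpen_ball hh hg)

end HarmonicMap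

section IntegralFromZero

variable {p : ℂ → ℂ} {z : ℂ}

theorem unitDisk_mem_nhds (hz : z ∈ unitDisk) : unitDisk ∈ 𝓝 z :=
  isOpen_ball.mem_nhds hz

theorem zero_mem_unitDisk : (0 : ℂ) ∈ unitDisk := mem_ball_self one_pos

theorem mem_unitDisk_iff : z ∈ unitDisk ↔ ‖z‖ < 1 := mem_ball_zero_iff

theorem ofReal_mem_unitDisk {r : ℝ} (hr : r ∈ Ico (0 : ℝ) 1) : (r : ℂ) ∈ unitDisk := by
  rw [mem_unitDisk_iff, norm_real, Real.norm_of_nonneg hr.1]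
  exact hr.2

theorem ofReal_mul_mem_unitDisk (hz : z ∈ unitDisk) {t : ℝ} (ht : t ∈ Icc (0 : ℝ) 1) :
    (t : ℂ) * z ∈ unitDisk := by
  rw [← real_smul]
  exact starConvex_zero_iff.1 ((convex_ball 0 1).starConvex zero_mem_unitDisk) hz ht.1 ht.2

theorem ofReal_norm_mem_unitDisk (hz : z ∈ unitDisk) : (‖z‖ : ℂ) ∈ unitDisk :=
  ofReal_mem_unitDisk ⟨norm_nonneg z, mem_unitDisk_iff.1 hz⟩

theorem mul_dslope_zero (hp0 : p 0 = 0) (z : ℂ) : z * dslope p 0 z = p z := by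
  simpa [hp0] using sub_smul_dslope p 0 z

theorem differentiableOn_dslope_zero (hp : DifferentiableOn ℂ p unitDisk) :
    DifferentiableOn ℂ (dslope p 0) unitDisk :=
  (differentiableOn_dslope (unitDisk_mem_nhds zero_mem_unitDisk)).2 hp

theorem integralFromZero_zero (p : ℂ → ℂ) : integralFromZero p 0 = 0 := by
  simp [integralFromZero]

theorem integralFromZero_div_eq (hp0 : p 0 = 0) (z : ℂ) :
    integralFromZero (fun t => p t / t) z = ∫ s in (0 : ℝ)..1, dslope p 0 (s * z) * z := by
  refine intervalIntegral.integral_congr_Ioo_of_le zero_le_one fun s hs => ?_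
  rcases eq_or_ne z 0 with rfl | hz
  · simp
  · have hsz : (s : ℂ) * z ≠ 0 := mul_ne_zero (ofReal_ne_zero.2 hs.1.ne') hz
    simp only [← mul_dslope_zero hp0 (s * z), mul_div_cancel_left₀ _ hsz]

theorem continuousOn_dslope_mul (hp : DifferentiableOn ℂ p unitDisk) (hz : z ∈ unitDisk) :
    ContinuousOn (fun s : ℝ => dslope p 0 (s * z) * z) (uIcc 0 1) := by
  rw [uIcc_of_le zero_le_one]
  exact ((differentiableOn_dslope_zero hp).continuousOn.comp (by fun_prop)
    fun s hs => ofReal_mul_mem_unitDisk hz hs).mul continuousOn_const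

theorem hasDerivAt_integralFromZero_div (hp : DifferentiableOn ℂ p unitDisk) (hp0 : p 0 = 0)
    (hz : z ∈ unitDisk) :
    HasDerivAt (integralFromZero fun t => p t / t) (dslope p 0 z) z := by
  obtain ⟨G, hG0, hG⟩ := (DifferentiableOn.isExactOn_ball
    (differentiableOn_dslope_zero hp)).with_val_at 0 0
  refine (hG z hz).congr_of_eventuallyEq ?_
  filter_upwards [unitDisk_mem_nhds hz] with w hw
  have hray (s : ℝ) (hs : s ∈ uIcc 0 1) :
      HasDerivAt (fun t : ℝ => G (t * w)) (dslope p 0 (s * w) * w) s := by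
    rw [uIcc_of_le zero_le_one] at hs
    have hmul : HasDerivAt (fun t : ℝ => (t : ℂ) * w) w s := by
      simpa using (ofRealCLM.hasDerivAt (x := s)).mul_const w
    exact (hG _ (ofReal_mul_mem_unitDisk hw hs)).comp_of_eq s hmul rfl
  rw [integralFromZero_div_eq hp0, intervalIntegral.integral_eq_sub_of_hasDerivAt hray
    (continuousOn_dslope_mul hp hw).intervalIntegrable]
  simp [hG0]

theorem differentiableOn_integralFromZero_div (hp : DifferentiableOn ℂ p unitDisk)
    (hp0 : p 0 = 0) : DifferentiableOn ℂ (integralFromZero fun t => p t / t) unitDisk :=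
  fun _ hz => (hasDerivAt_integralFromZero_div hp hp0 hz).differentiableAt.differentiableWithinAt

end IntegralFromZero

section Extremal

variable {p h : ℂ → ℂ} {z : ℂ}

theorem hasDerivAt_maMindaExtremal (hp : DifferentiableOn ℂ p unitDisk) (hp0 : p 0 = 1)
    (hz : z ∈ unitDisk) :
    HasDerivAt (maMindaExtremal p) (p z * exp (integralFromZero (fun t => (p t - 1) / t) z)) z := by
  have h0 : (fun t => p t - 1) 0 = 0 := sub_eq_zero.2 hp0
  refine ((hasDerivAt_id z).mul
    (hasDerivAt_integralFromZero_div (hp.sub_const 1) h0 hz).cexp).congr_deriv ?_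
  have hz' : z * dslope (fun t => p t - 1) 0 z = p z - 1 := mul_dslope_zero h0 z
  simp only [id]
  linear_combination exp (integralFromZero (fun t => (p t - 1) / t) z) * hz'

theorem dslope_maMindaExtremal (hp : DifferentiableOn ℂ p unitDisk) (hp0 : p 0 = 1) (z : ℂ) :
    dslope (maMindaExtremal p) 0 z = exp (integralFromZero (fun t => (p t - 1) / t) z) := by
  rcases eq_or_ne z 0 with rfl | hz
  · rw [dslope_same, (hasDerivAt_maMindaExtremal hp hp0 zero_mem_unitDisk).deriv, hp0, one_mul]
  · exact mul_left_cancel₀ hz (mul_dslope_zero (by simp [maMindaExtremal]) z)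

theorem eqOn_unitDisk_of_forall_ne_zero {u v : ℂ → ℂ} (hu : ContinuousOn u unitDisk)
    (hv : ContinuousOn v unitDisk) (huv : ∀ z ∈ unitDisk, z ≠ 0 → u z = v z) :
    EqOn u v unitDisk :=
  EqOn.of_subset_closure (s := unitDisk ∩ {0}ᶜ) (fun z hz => huv z hz.1 hz.2) hu hv
    inter_subset_left ((dense_compl_singleton 0).open_subset_closure_inter isOpen_ball)

theorem deriv_dslope_zero_eqOn (hp : DifferentiableOn ℂ p unitDisk) (hp0 : p 0 = 1)
    (hh : DifferentiableOn ℂ h unitDisk) (h0 : h 0 = 0)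
    (heq : ∀ z ∈ unitDisk, z * deriv h z = p z * h z) :
    EqOn (deriv (dslope h 0)) (fun z => dslope (fun t => p t - 1) 0 z * dslope h 0 z) unitDisk := by
  set d := dslope (fun t => p t - 1) 0
  set k := dslope h 0 with hk
  have hp1 : (fun t => p t - 1) 0 = 0 := sub_eq_zero.2 hp0
  have hd : DifferentiableOn ℂ d unitDisk := differentiableOn_dslope_zero (hp.sub_const 1)
  have hkd : DifferentiableOn ℂ k unitDisk := differentiableOn_dslope_zero hh
  refine eqOn_unitDisk_of_forall_ne_zero (hkd.deriv isOpen_ball).continuousOn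
    (hd.continuousOn.mul hkd.continuousOn) fun z hz hz0 => ?_
  have hdz : z * d z = p z - 1 := mul_dslope_zero hp1 z
  have hkz : z * k z = h z := mul_dslope_zero h0 z
  have hprod : deriv h z = k z + z * deriv k z := by
    have hmul : HasDerivAt (fun w => w * k w) (1 * k z + z * deriv k z) z :=
      (hasDerivAt_id z).mul (hkd.differentiableAt (unitDisk_mem_nhds hz)).hasDerivAt
    rw [← one_mul (k z), ← hmul.deriv]
    simp only [hk, mul_dslope_zero h0]
  refine mul_left_cancel₀ (pow_ne_zero 2 hz0) ?_
  linear_combination heq z hz - z * hprod - p z * hkz - z * k z * hdz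

/-- Division by `z` turns the singular equation `z h' = p h` into the regular linear equation
`k' = d k` for `k = h / z`, where `d = (p - 1) / z`. -/
theorem eqOn_maMindaExtremal (hp : DifferentiableOn ℂ p unitDisk) (hp0 : p 0 = 1)
    (hh : DifferentiableOn ℂ h unitDisk) (h0 : h 0 = 0) (h1 : deriv h 0 = 1)
    (heq : ∀ z ∈ unitDisk, z * deriv h z = p z * h z) : EqOn h (maMindaExtremal p) unitDisk := by
  set q := integralFromZero fun t => (p t - 1) / t with hq
  have hderiv (z : ℂ) (hz : z ∈ unitDisk) :
      HasDerivAt (fun w => dslope h 0 w * exp (-q w)) 0 z := by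
    have hk := ((differentiableOn_dslope_zero hh).differentiableAt
      (unitDisk_mem_nhds hz)).hasDerivAt
    have hqd : HasDerivAt q (dslope (fun t => p t - 1) 0 z) z :=
      hasDerivAt_integralFromZero_div (hp.sub_const 1) (sub_eq_zero.2 hp0) hz
    refine (hk.mul hqd.neg.cexp).congr_deriv ?_
    rw [deriv_dslope_zero_eqOn hp hp0 hh h0 heq hz]
    ring
  intro z hz
  have hconst : dslope h 0 z * exp (-q z) = 1 := by
    rw [isOpen_ball.is_const_of_deriv_eq_zero (convex_ball (0 : ℂ) 1).isPreconnected
      (fun w hw => (hderiv w hw).differentiableAt.differentiableWithinAt)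
      (fun w hw => (hderiv w hw).deriv) hz zero_mem_unitDisk]
    simp [hq, h1, integralFromZero_zero]
  rw [exp_neg, ← div_eq_mul_inv, div_eq_one_iff_eq (exp_ne_zero _)] at hconst
  rw [← mul_dslope_zero h0 z, hconst, maMindaExtremal]

end Extremal

section Majorant

/-- `P` is real on `[0, 1)` and dominates the moduli of the values of `p` on every circle
`|z| = r < 1`. In the order of `ℂ`, `a ≤ b` includes `a.im = b.im`. -/
def IsRadialMajorant (P p : ℂ → ℂ) : Prop := ∀ z ∈ unitDisk, (‖p z‖ : ℂ) ≤ P ‖z‖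

variable {P p ψ ω : ℂ → ℂ} {a b A B z : ℂ}

theorem norm_exp_sub_one_le_exp_sub_one (ha : (‖a‖ : ℂ) ≤ A) :
    (‖exp a - 1‖ : ℂ) ≤ exp A - 1 := by
  obtain ⟨M, rfl⟩ : ∃ M : ℝ, A = M := ⟨A.re, eq_re_of_ofReal_le ha⟩
  have hM : ‖a‖ ≤ M := by exact_mod_cast ha
  have hexp : ‖exp a - 1‖ ≤ Real.exp ‖a‖ - 1 := by
    simpa using norm_exp_sub_sum_le_exp_norm_sub_sum a 1
  exact_mod_cast hexp.trans (sub_le_sub_right (Real.exp_le_exp.2 hM) 1)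

theorem norm_mul_sub_one_le_mul_sub_one (ha : (‖a - 1‖ : ℂ) ≤ A - 1)
    (hb : (‖b - 1‖ : ℂ) ≤ B - 1) : (‖a * b - 1‖ : ℂ) ≤ A * B - 1 := by
  have htri : ‖a * b - 1‖ ≤ ‖a - 1‖ * ‖b - 1‖ + (‖a - 1‖ + ‖b - 1‖) := by
    calc ‖a * b - 1‖ = ‖(a - 1) * (b - 1) + ((a - 1) + (b - 1))‖ := by ring_nf
      _ ≤ ‖a - 1‖ * ‖b - 1‖ + (‖a - 1‖ + ‖b - 1‖) := by
          rw [← norm_mul]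
          exact (norm_add_le _ _).trans (by gcongr; exact norm_add_le _ _)
  have hA : 0 ≤ A - 1 := le_trans (by simp) ha
  calc (‖a * b - 1‖ : ℂ) ≤ ‖a - 1‖ * ‖b - 1‖ + (‖a - 1‖ + ‖b - 1‖) := by exact_mod_cast htri
    _ ≤ (A - 1) * (B - 1) + ((A - 1) + (B - 1)) := by gcongr
    _ = A * B - 1 := by ring

theorem IsRadialMajorant.integralFromZero_div (h : IsRadialMajorant P p)
    (hP : DifferentiableOn ℂ P unitDisk) (hP0 : P 0 = 0) (hp0 : p 0 = 0) :
    IsRadialMajorant (integralFromZero fun t => P t / t) (integralFromZero fun t => p t / t) := by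
  intro z hz
  have hbound (s : ℝ) (hs : s ∈ Ioc 0 1) :
      (‖dslope p 0 (s * z) * z‖ : ℂ) ≤ dslope P 0 (s * ‖z‖) * ‖z‖ := by
    have hs0 : (0 : ℂ) < s := by exact_mod_cast hs.1
    have hsz : (‖(s : ℂ) * z‖ : ℂ) = s * ‖z‖ := by
      rw [norm_mul, norm_real, Real.norm_of_nonneg hs.1.le, ofReal_mul]
    have hle := h _ (ofReal_mul_mem_unitDisk hz (Ioc_subset_Icc_self hs))
    rw [hsz, ← mul_dslope_zero hp0 (s * z), ← mul_dslope_zero hP0 (s * ‖z‖), mul_assoc (s : ℂ),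
      mul_assoc (s : ℂ), norm_mul, norm_real, Real.norm_of_nonneg hs.1.le, ofReal_mul] at hle
    simpa only [mul_comm] using le_of_mul_le_mul_left hle hs0
  have hreal : ∫ s in (0 : ℝ)..1, dslope P 0 (s * ‖z‖) * ‖z‖ =
      ((∫ s in (0 : ℝ)..1, (dslope P 0 (s * ‖z‖) * ‖z‖).re : ℝ) : ℂ) := by
    rw [← intervalIntegral.integral_ofReal]
    exact intervalIntegral.integral_congr_Ioo_of_le zero_le_one fun s hs =>
      eq_re_of_ofReal_le (hbound s (Ioo_subset_Ioc_self hs))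
  have hc := continuousOn_dslope_mul hP (ofReal_norm_mem_unitDisk hz)
  rw [integralFromZero_div_eq hp0, integralFromZero_div_eq hP0, hreal, real_le_real]
  refine intervalIntegral.norm_integral_le_of_norm_le zero_le_one
    (Filter.Eventually.of_forall fun s hs => ?_)
    (continuous_re.comp_continuousOn hc).intervalIntegrable
  exact (Complex.le_def.1 (hbound s hs)).1

theorem norm_sub_apply_zero_le_of_coeff_nonneg (hψ : DifferentiableOn ℂ ψ unitDisk)
    (hcoeff : ∀ n, 0 ≤ iteratedDeriv n ψ 0) {r : ℝ} (hzr : ‖z‖ ≤ r) (hr : r < 1) :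
    (‖ψ z - ψ 0‖ : ℂ) ≤ ψ r - ψ 0 := by
  have hr0 : 0 ≤ r := (norm_nonneg z).trans hzr
  have hsum {w : ℂ} (hw : w ∈ unitDisk) : HasSum
      (fun n => ((n + 1).factorial : ℂ)⁻¹ * iteratedDeriv (n + 1) ψ 0 * w ^ (n + 1))
      (ψ w - ψ 0) := by
    simpa [mul_assoc, mul_comm, mul_left_comm] using
      (hasSum_nat_add_iff' 1).2 (hasSum_taylorSeries_on_ball hψ hw)
  have hterm (n : ℕ) :
      0 ≤ ((n + 1).factorial : ℂ)⁻¹ * iteratedDeriv (n + 1) ψ 0 * (r : ℂ) ^ (n + 1) :=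
    mul_nonneg (mul_nonneg (by positivity) (hcoeff _)) (pow_nonneg (by exact_mod_cast hr0) _)
  have hsum_r := hsum (ofReal_mem_unitDisk ⟨hr0, hr⟩)
  have hre : ψ r - ψ 0 = ((ψ r - ψ 0).re : ℂ) :=
    eq_re_of_ofReal_le (r := 0) (by simpa using hsum_r.nonneg hterm)
  rw [hre, real_le_real]
  refine (hsum (mem_unitDisk_iff.2 (hzr.trans_lt hr))).norm_le_of_bounded
    (hasSum_re hsum_r) fun n => ?_
  rw [re_eq_norm.2 (hterm n)]
  simp only [norm_mul, norm_pow, norm_real, Real.norm_of_nonneg hr0]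
  gcongr

theorem isRadialMajorant_sub_apply_zero_comp (hψ : DifferentiableOn ℂ ψ unitDisk)
    (hcoeff : ∀ n, 0 ≤ iteratedDeriv n ψ 0) (hω : DifferentiableOn ℂ ω unitDisk)
    (hmaps : MapsTo ω unitDisk unitDisk) (hω0 : ω 0 = 0) :
    IsRadialMajorant (fun z => ψ z - ψ 0) (fun z => ψ (ω z) - ψ 0) := fun _ hz =>
  norm_sub_apply_zero_le_of_coeff_nonneg hψ hcoeff (norm_le_norm_of_mapsTo_ball hω
    (hmaps.mono_right ball_subset_closedBall) hω0 (mem_unitDisk_iff.1 hz)) (mem_unitDisk_iff.1 hz)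

theorem IsRadialMajorant.im_eq_zero (h : IsRadialMajorant P p) {r : ℝ}
    (hr : r ∈ Ico (0 : ℝ) 1) : (P r).im = 0 := by
  have hle := h r (ofReal_mem_unitDisk hr)
  rw [norm_real, Real.norm_of_nonneg hr.1] at hle
  exact (Complex.le_def.1 hle).2.symm

theorem IsRadialMajorant.norm_le (h : IsRadialMajorant P p) (hz : z ∈ unitDisk) :
    ‖p z‖ ≤ (P ‖z‖).re :=
  (Complex.le_def.1 (h z hz)).1

theorem IsRadialMajorant.dslope_maMindaExtremal_sub_one
    (h : IsRadialMajorant (fun z => P z - 1) (fun z => p z - 1))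
    (hP : DifferentiableOn ℂ P unitDisk) (hP0 : P 0 = 1) (hp : DifferentiableOn ℂ p unitDisk)
    (hp0 : p 0 = 1) :
    IsRadialMajorant (fun z => dslope (maMindaExtremal P) 0 z - 1)
      (fun z => dslope (maMindaExtremal p) 0 z - 1) := by
  intro z hz
  simp only [dslope_maMindaExtremal hP hP0, dslope_maMindaExtremal hp hp0]
  exact norm_exp_sub_one_le_exp_sub_one
    (h.integralFromZero_div (hP.sub_const 1) (sub_eq_zero.2 hP0) (sub_eq_zero.2 hp0) z hz)

theorem IsRadialMajorant.deriv_maMindaExtremal_sub_one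
    (h : IsRadialMajorant (fun z => P z - 1) (fun z => p z - 1))
    (hP : DifferentiableOn ℂ P unitDisk) (hP0 : P 0 = 1) (hp : DifferentiableOn ℂ p unitDisk)
    (hp0 : p 0 = 1) :
    IsRadialMajorant (fun z => deriv (maMindaExtremal P) z - 1)
      (fun z => deriv (maMindaExtremal p) z - 1) := by
  intro z hz
  have hk := h.dslope_maMindaExtremal_sub_one hP hP0 hp hp0 z hz
  simp only [dslope_maMindaExtremal hP hP0, dslope_maMindaExtremal hp hp0] at hk
  simp only [(hasDerivAt_maMindaExtremal hP hP0 (ofReal_norm_mem_unitDisk hz)).deriv,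
    (hasDerivAt_maMindaExtremal hp hp0 hz).deriv]
  exact norm_mul_sub_one_le_mul_sub_one (h z hz) hk

end Majorant

section GrowthAndDistortion

variable {ψ p h : ℂ → ℂ}

theorem mul_deriv_eq_of_starlikeQuotient_eq (hh : DifferentiableOn ℂ h unitDisk) (h0 : h 0 = 0)
    (h1 : deriv h 0 ≠ 0) (hp : DifferentiableOn ℂ p unitDisk)
    (hq : ∀ z ∈ unitDisk, starlikeQuotient h z = p z) :
    ∀ z ∈ unitDisk, z * deriv h z = p z * h z := by
  have hd0 : HasDerivAt h (deriv h 0) 0 :=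
    (hh.differentiableAt (unitDisk_mem_nhds zero_mem_unitDisk)).hasDerivAt
  have hev : (fun z => z * deriv h z) =ᶠ[𝓝 0] fun z => p z * h z := by
    filter_upwards [unitDisk_mem_nhds zero_mem_unitDisk,
      eventually_nhdsWithin_iff.1 (hd0.eventually_ne (c := 0) h1)] with z hz hne
    rcases eq_or_ne z 0 with rfl | hz0
    · simp [h0]
    · rw [← hq z hz, starlikeQuotient, if_neg hz0, div_mul_cancel₀ _ (hne hz0)]
  exact ((differentiableOn_id.mul (hh.deriv isOpen_ball)).analyticOnNhd isOpen_ball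
    ).eqOn_of_preconnected_of_eventuallyEq ((hp.mul hh).analyticOnNhd isOpen_ball)
    (convex_ball (0 : ℂ) 1).isPreconnected zero_mem_unitDisk hev

theorem dslope_zero_eqOn {u v : ℂ → ℂ} (huv : EqOn u v unitDisk) :
    EqOn (dslope u 0) (dslope v 0) unitDisk := by
  intro z hz
  rcases eq_or_ne z 0 with rfl | hz0
  · simpa only [dslope_same] using huv.deriv isOpen_ball hz
  · simp only [dslope_of_ne _ hz0, slope_def_module, huv hz, huv zero_mem_unitDisk]

theorem IsMaMindaStarlike.exists_eqOn_maMindaExtremal (hh : IsMaMindaStarlike ψ h)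
    (hψ : DifferentiableOn ℂ ψ unitDisk) (hψ0 : ψ 0 = 1)
    (hcoeff : ∀ n, 0 ≤ iteratedDeriv n ψ 0) :
    ∃ p : ℂ → ℂ, DifferentiableOn ℂ p unitDisk ∧ p 0 = 1 ∧
      IsRadialMajorant (fun z => ψ z - 1) (fun z => p z - 1) ∧
      EqOn h (maMindaExtremal p) unitDisk := by
  obtain ⟨ω, hω, hmaps, hω0, hq⟩ := hh.subordinate
  have hp : DifferentiableOn ℂ (fun z => ψ (ω z)) unitDisk := hψ.comp hω hmaps
  have hp0 : ψ (ω 0) = 1 := by rw [hω0, hψ0]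
  have heq : ∀ z ∈ unitDisk, z * deriv h z = ψ (ω z) * h z :=
    mul_deriv_eq_of_starlikeQuotient_eq hh.differentiableOn hh.map_zero
      (hh.deriv_zero ▸ one_ne_zero) hp hq
  exact ⟨fun z => ψ (ω z), hp, hp0,
    hψ0 ▸ isRadialMajorant_sub_apply_zero_comp hψ hcoeff hω hmaps hω0,
    eqOn_maMindaExtremal hp hp0 hh.differentiableOn hh.map_zero hh.deriv_zero heq⟩

theorem IsMaMindaStarlike.isRadialMajorant_deriv_sub_one (hh : IsMaMindaStarlike ψ h)
    (hψ : DifferentiableOn ℂ ψ unitDisk) (hψ0 : ψ 0 = 1)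
    (hcoeff : ∀ n, 0 ≤ iteratedDeriv n ψ 0) :
    IsRadialMajorant (fun z => deriv (maMindaExtremal ψ) z - 1) (fun z => deriv h z - 1) := by
  obtain ⟨p, hp, hp0, hmaj, heq⟩ := hh.exists_eqOn_maMindaExtremal hψ hψ0 hcoeff
  intro z hz
  simpa only [heq.deriv isOpen_ball hz] using
    hmaj.deriv_maMindaExtremal_sub_one hψ hψ0 hp hp0 z hz

theorem IsMaMindaStarlike.isRadialMajorant_dslope_sub_one (hh : IsMaMindaStarlike ψ h)
    (hψ : DifferentiableOn ℂ ψ unitDisk) (hψ0 : ψ 0 = 1)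
    (hcoeff : ∀ n, 0 ≤ iteratedDeriv n ψ 0) :
    IsRadialMajorant (fun z => dslope (maMindaExtremal ψ) 0 z - 1)
      (fun z => dslope h 0 z - 1) := by
  obtain ⟨p, hp, hp0, hmaj, heq⟩ := hh.exists_eqOn_maMindaExtremal hψ hψ0 hcoeff
  intro z hz
  simpa only [dslope_zero_eqOn heq hz] using
    hmaj.dslope_maMindaExtremal_sub_one hψ hψ0 hp hp0 z hz

theorem isMaMindaStarlike_maMindaExtremal (hψ : DifferentiableOn ℂ ψ unitDisk) (hψ0 : ψ 0 = 1) :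
    IsMaMindaStarlike ψ (maMindaExtremal ψ) where
  differentiableOn := fun _ hz =>
    (hasDerivAt_maMindaExtremal hψ hψ0 hz).differentiableAt.differentiableWithinAt
  map_zero := by simp [maMindaExtremal]
  deriv_zero := by
    simp [(hasDerivAt_maMindaExtremal hψ hψ0 zero_mem_unitDisk).deriv, hψ0, integralFromZero_zero]
  subordinate := by
    refine ⟨id, differentiableOn_id, mapsTo_id _, rfl, fun z hz => ?_⟩
    rcases eq_or_ne z 0 with rfl | hz0
    · simp [starlikeQuotient, hψ0]
    · rw [starlikeQuotient, if_neg hz0, (hasDerivAt_maMindaExtremal hψ hψ0 hz).deriv,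
        maMindaExtremal, id]
      field_simp

end GrowthAndDistortion

section Roots

theorem lt_of_forall_ne {u : ℝ → ℝ} {a b c : ℝ} (hu : ContinuousOn u (Ico a b)) (ha : u a < c)
    (hne : ∀ r ∈ Ioo a b, u r ≠ c) : ∀ r ∈ Ico a b, u r < c := by
  intro r hr
  by_contra! hcr
  obtain ⟨s, hs, hsc⟩ := intermediate_value_Icc hr.1
    (hu.mono (Icc_subset_Ico_right hr.2)) ⟨ha.le, hcr⟩
  have has : a ≠ s := fun has => ha.ne (has ▸ hsc)
  exact hne s ⟨hs.1.lt_of_ne has, hs.2.trans_lt hr.2⟩ hsc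

theorem exists_isLeast_setOf_eq {u : ℝ → ℝ} {a b c : ℝ} (hu : ContinuousOn u (Ico a b))
    (ha : u a ≠ c) (hne : {r | r ∈ Ioo a b ∧ u r = c}.Nonempty) :
    ∃ r₀, IsLeast {r | r ∈ Ioo a b ∧ u r = c} r₀ := by
  obtain ⟨r₁, hr₁, hur₁⟩ := hne
  have hcompact : IsCompact (Icc a r₁ ∩ u ⁻¹' {c}) :=
    isCompact_Icc.of_isClosed_subset ((hu.mono (Icc_subset_Ico_right hr₁.2)
      ).preimage_isClosed_of_isClosed isClosed_Icc isClosed_singleton) inter_subset_left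
  obtain ⟨r₀, ⟨hr₀, hur₀⟩, hmin⟩ := hcompact.exists_isLeast ⟨r₁, ⟨hr₁.1.le, le_rfl⟩, hur₁⟩
  have har₀ : a ≠ r₀ := fun har₀ => ha (har₀ ▸ hur₀)
  refine ⟨r₀, ⟨⟨hr₀.1.lt_of_ne har₀, hr₀.2.trans_lt hr₁.2⟩, hur₀⟩, fun r hr => ?_⟩
  rcases le_total r r₁ with hrr₁ | hrr₁
  · exact hmin ⟨⟨hr.1.1.le, hrr₁⟩, hr.2⟩
  · exact hr₀.2.trans hrr₁

theorem exists_isLeast_and_apply_min {u : ℝ → ℝ} {a b c d : ℝ} {P : ℝ → Prop}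
    (hu : ContinuousOn u (Ico a b)) (ha : u a < c) (hd : d ≤ b)
    (hP : ∀ R ≤ d, (∀ r ∈ Ico a R, u r < c) → P R) :
    ({r | r ∈ Ioo a b ∧ u r = c}.Nonempty →
        ∃ r₀, IsLeast {r | r ∈ Ioo a b ∧ u r = c} r₀ ∧ P (min d r₀)) ∧
      ({r | r ∈ Ioo a b ∧ u r = c} = ∅ → P d) := by
  refine ⟨fun hne => ?_, fun hempty => hP d le_rfl ?_⟩
  · obtain ⟨r₀, hr₀⟩ := exists_isLeast_setOf_eq hu ha.ne hne
    have hlt : ∀ r ∈ Ico a r₀, u r < c :=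
      lt_of_forall_ne (hu.mono (Ico_subset_Ico_right hr₀.1.1.2.le)) ha fun r hr hur =>
        hr.2.not_ge (hr₀.2 ⟨⟨hr.1, hr.2.trans hr₀.1.1.2⟩, hur⟩)
    exact ⟨r₀, hr₀, hP _ (min_le_left d r₀) fun r hr =>
      hlt r ⟨hr.1, hr.2.trans_le (min_le_right d r₀)⟩⟩
  · have hlt : ∀ r ∈ Ico a b, u r < c := lt_of_forall_ne hu ha fun r hr hur =>
      eq_empty_iff_forall_notMem.1 hempty r ⟨hr, hur⟩
    exact fun r hr => hlt r ⟨hr.1, hr.2.trans_le hd⟩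

end Roots

section RootsOfExtremal

variable {ψ : ℂ → ℂ}

theorem derivRoots_eq (hψ : DifferentiableOn ℂ ψ unitDisk) (hψ0 : ψ 0 = 1)
    (hcoeff : ∀ n, 0 ≤ iteratedDeriv n ψ 0) :
    derivRoots ψ =
      {r | r ∈ Ioo (0 : ℝ) 1 ∧ (deriv (maMindaExtremal ψ) (r : ℂ)).re = 5 / 4} := by
  ext r
  refine and_congr_right fun hr => ?_
  have him : (deriv (maMindaExtremal ψ) r).im = 0 := by
    simpa using ((isMaMindaStarlike_maMindaExtremal hψ hψ0).isRadialMajorant_deriv_sub_one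
      hψ hψ0 hcoeff).im_eq_zero (Ioo_subset_Ico_self hr)
  simp [Complex.ext_iff, him, sub_eq_zero]

theorem valueRoots_eq (hψ : DifferentiableOn ℂ ψ unitDisk) (hψ0 : ψ 0 = 1)
    (hcoeff : ∀ n, 0 ≤ iteratedDeriv n ψ 0) :
    valueRoots ψ =
      {r | r ∈ Ioo (0 : ℝ) 1 ∧ (dslope (maMindaExtremal ψ) 0 (r : ℂ)).re = 5 / 4} := by
  ext r
  refine and_congr_right fun hr => ?_
  have hr0 : (r : ℂ) ≠ 0 := ofReal_ne_zero.2 hr.1.ne'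
  have hh := isMaMindaStarlike_maMindaExtremal hψ hψ0
  have him : (dslope (maMindaExtremal ψ) 0 r).im = 0 := by
    simpa using (hh.isRadialMajorant_dslope_sub_one hψ hψ0 hcoeff).im_eq_zero
      (Ioo_subset_Ico_self hr)
  have hfactor : 4 * maMindaExtremal ψ r - 5 * r =
      4 * r * (dslope (maMindaExtremal ψ) 0 r - 5 / 4) := by
    linear_combination -4 * mul_dslope_zero hh.map_zero r
  rw [hfactor, mul_eq_zero_iff_left (mul_ne_zero four_ne_zero hr0)]
  simp [Complex.ext_iff, him, sub_eq_zero]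

theorem continuousOn_re_deriv_maMindaExtremal (hψ : DifferentiableOn ℂ ψ unitDisk)
    (hψ0 : ψ 0 = 1) :
    ContinuousOn (fun r : ℝ => (deriv (maMindaExtremal ψ) r).re) (Ico 0 1) :=
  have hd := (isMaMindaStarlike_maMindaExtremal hψ hψ0).differentiableOn.deriv isOpen_ball
  continuous_re.comp_continuousOn
    (hd.continuousOn.comp continuous_ofReal.continuousOn fun _ => ofReal_mem_unitDisk)

theorem continuousOn_re_dslope_maMindaExtremal (hψ : DifferentiableOn ℂ ψ unitDisk)
    (hψ0 : ψ 0 = 1) :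
    ContinuousOn (fun r : ℝ => (dslope (maMindaExtremal ψ) 0 r).re) (Ico 0 1) :=
  have hd := differentiableOn_dslope_zero
    (isMaMindaStarlike_maMindaExtremal hψ hψ0).differentiableOn
  continuous_re.comp_continuousOn
    (hd.continuousOn.comp continuous_ofReal.continuousOn fun _ => ofReal_mem_unitDisk)

end RootsOfExtremal

section Radius

variable {ψ h g φ u v : ℂ → ℂ} {R : ℝ} {z : ℂ}

theorem norm_le_norm_mul_norm_of_eq_mul (hφ : IsBoundedByOne φ)
    (huv : ∀ z ∈ unitDisk, u z = φ z * v z) (hu0 : u 0 = 0) (hv0 : v 0 ≠ 0) (hz : z ∈ unitDisk) :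
    ‖u z‖ ≤ ‖z‖ * ‖v z‖ := by
  have hφ0 : φ 0 = 0 := by simpa [hu0, hv0, eq_comm] using huv 0 zero_mem_unitDisk
  rw [huv z hz, norm_mul]
  gcongr
  exact norm_le_norm_of_mapsTo_ball hφ.differentiableOn
    (fun w hw => mem_closedBall_zero_iff.2 (hφ.norm_le_one w hw)) hφ0 (mem_unitDisk_iff.1 hz)

theorem norm_le_norm_mul_norm_of_norm_lt (hu : DifferentiableOn ℂ u unitDisk)
    (hv : DifferentiableOn ℂ v unitDisk) (huv : ∀ z ∈ unitDisk, ‖u z‖ < ‖v z‖) (hu0 : u 0 = 0)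
    (hz : z ∈ unitDisk) : ‖u z‖ ≤ ‖z‖ * ‖v z‖ := by
  have hv0 (w : ℂ) (hw : w ∈ unitDisk) : v w ≠ 0 :=
    norm_pos_iff.1 ((norm_nonneg _).trans_lt (huv w hw))
  have hφ : IsBoundedByOne fun w => u w / v w :=
    { differentiableOn := hu.fun_div hv hv0
      norm_le_one := fun w hw => by
        rw [norm_div]
        exact div_le_one_of_le₀ (huv w hw).le (norm_nonneg _) }
  exact norm_le_norm_mul_norm_of_eq_mul hφ (fun w hw => (div_mul_cancel₀ _ (hv0 w hw)).symm) hu0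
    (hv0 0 zero_mem_unitDisk) hz

theorem dslope_zero_eq_mul_dslope (hφ : DifferentiableOn ℂ φ unitDisk)
    (hh : DifferentiableOn ℂ h unitDisk) (h0 : h 0 = 0) (hg : ∀ z ∈ unitDisk, g z = φ z * h z) :
    ∀ z ∈ unitDisk, dslope g 0 z = φ z * dslope h 0 z := by
  have hgd : DifferentiableOn ℂ g unitDisk := (hφ.mul hh).congr hg
  have g0 : g 0 = 0 := by rw [hg 0 zero_mem_unitDisk, h0, mul_zero]
  refine eqOn_unitDisk_of_forall_ne_zero (differentiableOn_dslope_zero hgd).continuousOn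
    (hφ.continuousOn.mul (differentiableOn_dslope_zero hh).continuousOn) fun z hz hz0 => ?_
  refine mul_left_cancel₀ hz0 ?_
  rw [mul_dslope_zero g0, hg z hz, mul_left_comm, mul_dslope_zero h0]

theorem norm_sub_one_add_norm_le {a b : ℂ} {r : ℝ} (hr : r ≤ 1 / 3) (ha : ‖a - 1‖ ≤ 1 / 4)
    (hb : ‖b‖ ≤ r * ‖a‖) : ‖a - 1‖ + ‖b‖ ≤ 2 / 3 := by
  have hnorm : ‖a‖ ≤ 5 / 4 := by
    have htri := norm_add_le (a - 1) 1
    rw [sub_add_cancel, norm_one] at htri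
    linarith
  nlinarith [norm_nonneg a]

theorem isUniformlyStarlike_harmonicMap_of_norm_deriv_le (hR : R ≤ 1 / 3)
    (hh : DifferentiableOn ℂ h (ball 0 R)) (hg : DifferentiableOn ℂ g (ball 0 R))
    (h0 : h 0 = 0) (g0 : g 0 = 0) (hh' : ∀ z ∈ ball 0 R, ‖deriv h z - 1‖ ≤ 1 / 4)
    (hg' : ∀ z ∈ ball 0 R, ‖deriv g z‖ ≤ ‖z‖ * ‖deriv h z‖) :
    IsUniformlyStarlike (harmonicMap h g) R := by
  refine isUniformlyStarlike_harmonicMap (k := 2 / 3) hh hg h0 g0 (by norm_num) fun z hz => ?_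
  exact_mod_cast norm_sub_one_add_norm_le ((mem_ball_zero_iff.1 hz).le.trans hR) (hh' z hz)
    (hg' z hz)

theorem isUniformlyStarlike_harmonicMap_of_forall_deriv_lt
    (hψ : DifferentiableOn ℂ ψ unitDisk) (hψ0 : ψ 0 = 1)
    (hcoeff : ∀ n, 0 ≤ iteratedDeriv n ψ 0) (hh : IsMaMindaStarlike ψ h)
    (hg : DifferentiableOn ℂ g unitDisk) (g0 : g 0 = 0) (hg'0 : deriv g 0 = 0)
    (hgh : ∀ z ∈ unitDisk, ‖deriv g z‖ < ‖deriv h z‖) (hR : R ≤ 1 / 3)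
    (hlt : ∀ r ∈ Ico 0 R, (deriv (maMindaExtremal ψ) (r : ℂ)).re < 5 / 4) :
    IsUniformlyStarlike (harmonicMap h g) R := by
  have hsub : ball (0 : ℂ) R ⊆ unitDisk := ball_subset_ball (by linarith)
  refine isUniformlyStarlike_harmonicMap_of_norm_deriv_le hR (hh.differentiableOn.mono hsub)
    (hg.mono hsub) hh.map_zero g0 (fun z hz => ?_) fun z hz => ?_
  · have hle := (hh.isRadialMajorant_deriv_sub_one hψ hψ0 hcoeff).norm_le (hsub hz)
    rw [sub_re, one_re] at hle
    linarith [hlt ‖z‖ ⟨norm_nonneg z, mem_ball_zero_iff.1 hz⟩]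
  · exact norm_le_norm_mul_norm_of_norm_lt (hg.deriv isOpen_ball)
      (hh.differentiableOn.deriv isOpen_ball) hgh hg'0 (hsub hz)

theorem isUniformlyStarlike_lambdaOperator_of_forall_dslope_lt
    (hψ : DifferentiableOn ℂ ψ unitDisk) (hψ0 : ψ 0 = 1)
    (hcoeff : ∀ n, 0 ≤ iteratedDeriv n ψ 0) (hh : IsMaMindaStarlike ψ h)
    (hφ : IsBoundedByOne φ) (hgφ : ∀ z ∈ unitDisk, g z = φ z * h z) (hg'0 : deriv g 0 = 0)
    (hR : R ≤ 1 / 3)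
    (hlt : ∀ r ∈ Ico 0 R, (dslope (maMindaExtremal ψ) 0 (r : ℂ)).re < 5 / 4) :
    IsUniformlyStarlike (lambdaOperator h g) R := by
  have hsub : ball (0 : ℂ) R ⊆ unitDisk := ball_subset_ball (by linarith)
  have hg : DifferentiableOn ℂ g unitDisk :=
    (hφ.differentiableOn.mul hh.differentiableOn).congr hgφ
  have g0 : g 0 = 0 := by rw [hgφ 0 zero_mem_unitDisk, hh.map_zero, mul_zero]
  have hH' (z : ℂ) (hz : z ∈ ball 0 R) := (hasDerivAt_integralFromZero_div hh.differentiableOn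
    hh.map_zero (hsub hz)).deriv
  have hG' (z : ℂ) (hz : z ∈ ball 0 R) := (hasDerivAt_integralFromZero_div hg g0 (hsub hz)).deriv
  refine isUniformlyStarlike_harmonicMap_of_norm_deriv_le hR
    ((differentiableOn_integralFromZero_div hh.differentiableOn hh.map_zero).mono hsub)
    ((differentiableOn_integralFromZero_div hg g0).mono hsub)
    (integralFromZero_zero _) (integralFromZero_zero _) (fun z hz => ?_) fun z hz => ?_
  · rw [hH' z hz]
    have hle := (hh.isRadialMajorant_dslope_sub_one hψ hψ0 hcoeff).norm_le (hsub hz)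
    rw [sub_re, one_re] at hle
    linarith [hlt ‖z‖ ⟨norm_nonneg z, mem_ball_zero_iff.1 hz⟩]
  · rw [hH' z hz, hG' z hz]
    exact norm_le_norm_mul_norm_of_eq_mul hφ (dslope_zero_eq_mul_dslope hφ.differentiableOn
      hh.differentiableOn hh.map_zero hgφ) (by rw [dslope_same, hg'0])
      (by simp [hh.deriv_zero]) (hsub hz)

end Radius

theorem mainTheorem10_general {ψ h g φ : ℂ → ℂ} (hψ : DifferentiableOn ℂ ψ unitDisk)
    (hψ0 : ψ 0 = 1) (hcoeff : ∀ n, 0 ≤ iteratedDeriv n ψ 0) (hh : IsMaMindaStarlike ψ h)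
    (hφ : IsBoundedByOne φ) (hgφ : ∀ z ∈ unitDisk, g z = φ z * h z) (hg'0 : deriv g 0 = 0)
    (hgh : ∀ z ∈ unitDisk, ‖deriv g z‖ < ‖deriv h z‖) :
    (((derivRoots ψ).Nonempty → ∃ rψ : ℝ, IsLeast (derivRoots ψ) rψ ∧
        IsUniformlyStarlike (harmonicMap h g) (min (1 / 3) rψ)) ∧
      (derivRoots ψ = ∅ → IsUniformlyStarlike (harmonicMap h g) (1 / 3))) ∧
    (((valueRoots ψ).Nonempty → ∃ rψ : ℝ, IsLeast (valueRoots ψ) rψ ∧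
        IsUniformlyStarlike (lambdaOperator h g) (min (1 / 3) rψ)) ∧
      (valueRoots ψ = ∅ → IsUniformlyStarlike (lambdaOperator h g) (1 / 3))) := by
  have hg : DifferentiableOn ℂ g unitDisk :=
    (hφ.differentiableOn.mul hh.differentiableOn).congr hgφ
  have g0 : g 0 = 0 := by rw [hgφ 0 zero_mem_unitDisk, hh.map_zero, mul_zero]
  have hderiv0 : deriv (maMindaExtremal ψ) 0 = 1 :=
    (isMaMindaStarlike_maMindaExtremal hψ hψ0).deriv_zero
  rw [derivRoots_eq hψ hψ0 hcoeff, valueRoots_eq hψ hψ0 hcoeff]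
  constructor
  · refine exists_isLeast_and_apply_min (continuousOn_re_deriv_maMindaExtremal hψ hψ0)
      (by norm_num [hderiv0]) (by norm_num) fun R hR hlt => ?_
    exact isUniformlyStarlike_harmonicMap_of_forall_deriv_lt hψ hψ0 hcoeff hh hg g0 hg'0 hgh hR hlt
  · refine exists_isLeast_and_apply_min (continuousOn_re_dslope_maMindaExtremal hψ hψ0)
      (by norm_num [hderiv0]) (by norm_num) fun R hR hlt => ?_
    exact isUniformlyStarlike_lambdaOperator_of_forall_dslope_lt hψ hψ0 hcoeff hh hφ hgφ hg'0 hR hlt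

theorem mainTheorem10 (ψ h g φ : ℂ → ℂ)
    (hψ : IsMaMindaFunction ψ)
    (hh : IsMaMindaStarlike ψ h)
    (hφ : IsBoundedByOne φ)
    (hg : ∀ z ∈ unitDisk, g z = φ z * h z)
    (hf : IsClassSH0 h g) :
    (((derivRoots ψ).Nonempty → ∃ rψ : ℝ, IsLeast (derivRoots ψ) rψ ∧
        IsUniformlyStarlike (harmonicMap h g) (min (1 / 3) rψ)) ∧
      (derivRoots ψ = ∅ → IsUniformlyStarlike (harmonicMap h g) (1 / 3))) ∧
    (((valueRoots ψ).Nonempty → ∃ rψ : ℝ, IsLeast (valueRoots ψ) rψ ∧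
        IsUniformlyStarlike (lambdaOperator h g) (min (1 / 3) rψ)) ∧
      (valueRoots ψ = ∅ → IsUniformlyStarlike (lambdaOperator h g) (1 / 3))) :=
  mainTheorem10_general hψ.differentiableOn hψ.map_zero
    (fun n => nonneg_iff.2 ⟨(hψ.coeff_nonneg n).1, (hψ.coeff_nonneg n).2.symm⟩) hh hφ hg
    hf.deriv_right_zero fun z hz =>
      lt_of_pow_lt_pow_left₀ 2 (norm_nonneg _) (sub_pos.1 (hf.jacobian_pos z hz))
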